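/- Let $p$ be a prime number and let $F$ be a field of characteristic different from $p$, with separable closure $F_{sep}$. For $m\ge 1$ let $\zeta_{p^m}\in F_{sep}$ be a primitive $p^m$-th root of unity, and let $\mu_{p^\infty}=\bigcup_{n\ge 1}\{z\in F_{sep} : z^{p^n}=1\}$. Let $CR(F)\subseteq F_{sep}$ be the compositum of the fields $F(\sqrt[p^m]{a},\zeta_{p^m})$, where $m$ runs over the integers $\ge 1$ and $a$ over $F^\times$. Suppose that $\mu_{p^\infty}\subseteq F$, and let $I$ be a set with $\#I=\dim_{\mathbb F_p}F^\times/(F^\times)^p$ (an equality of cardinal numbers, possibly infinite). Then $CR(F)/F$ is a Galois extension, and there are isomorphisms of topological groups \[ \mathrm{Gal}(CR(F)/F)\;\simeq\;\langle \tau_i,\ i\in I\mid [\tau_i,\tau_j]=1\ \text{for all } i,j\in I\rangle\;\simeq\;\prod_{i\in I}\mathbb Z_p . \] Here $\mathrm{Gal}(CR(F)/F)$ carries the Krull topology and $\prod_{i\in I}\mathbb Z_p$ the product topology. The middle group is presented as a pro-$p$ group: it is the quotient of the free pro-$p$ group $S$ on $\{\tau_i\}_{i\in I}$ by the closed normal subgroup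 generated by the commutators $[\tau_i,\tau_j]=\tau_i\tau_j\tau_i^{-1}\tau_j^{-1}$. The group $S$ is the inverse limit of the quotients $\Phi/N$, where $\Phi$ is the abstract free group on $\{\tau_i\}_{i\in I}$ and $N$ runs over the normal subgroups of $p$-power index that contain all but finitely many of the $\tau_i$. -/

import Mathlib

universe u v w

/-- The group `μ_{p^∞}` of all roots of unity of `p`-power order in a field `K`, as a subset of
`K`: the union over `n ≥ 1` of the sets of `p ^ n`-th roots of unity. -/
def muPInf (p : ℕ) (K : Type*) [Field K] : Set K :=
  {z : K | ∃ n : ℕ, 1 ≤ n ∧ z ^ p ^ n = 1}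

/-- The extension `F(a^{1/p^m}, ζ_{p^m})` of `F` inside `L`. All `p ^ m`-th roots of `a` are
adjoined: together with a primitive `p ^ m`-th root of unity this gives the same field as
adjoining a single one of them. -/
def radicalExt (p : ℕ) (F L : Type*) [Field F] [Field L] [Algebra F L] (a : Fˣ) (m : ℕ) :
    IntermediateField F L :=
  IntermediateField.adjoin F
    ({x : L | x ^ p ^ m = algebraMap F L a} ∪ {z : L | IsPrimitiveRoot z (p ^ m)})

/-- The `p`-cyclotomic radical extension `CR(F)` of `F` inside `L`: the compositum of the fields
`F(a^{1/p^m}, ζ_{p^m})` for `m ≥ 1` and `a ∈ Fˣ`. -/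
def cyclotomicRadicalExt (p : ℕ) (F L : Type*) [Field F] [Field L] [Algebra F L] :
    IntermediateField F L :=
  ⨆ (m : ℕ) (_ : 1 ≤ m) (a : Fˣ), radicalExt p F L a m

/-- The group `Fˣ / (Fˣ)^p` of `p`-th power classes, written additively. -/
def PowerClasses (p : ℕ) (F : Type*) [Field F] : Type _ :=
  Additive (Fˣ ⧸ (powMonoidHom p : Fˣ →* Fˣ).range)

instance PowerClasses.instAddCommGroup (p : ℕ) (F : Type*) [Field F] :
    AddCommGroup (PowerClasses p F) :=
  inferInstanceAs (AddCommGroup (Additive (Fˣ ⧸ (powMonoidHom p : Fˣ →* Fˣ).range)))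

theorem PowerClasses.nsmul_eq_zero (p : ℕ) (F : Type*) [Field F] (x : PowerClasses p F) :
    p • x = 0 := by
  have key : ∀ y : Fˣ ⧸ (powMonoidHom p : Fˣ →* Fˣ).range, y ^ p = 1 := by
    intro y
    induction y using QuotientGroup.induction_on with
    | H z =>
      rw [← QuotientGroup.mk_pow, QuotientGroup.eq_one_iff]
      exact ⟨z, rfl⟩
  exact key x

/-- `Fˣ / (Fˣ)^p` as a vector space over the field with `p` elements. -/
instance PowerClasses.instModule (p : ℕ) (F : Type*) [Field F] :
    Module (ZMod p) (PowerClasses p F) :=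
  AddCommGroup.zmodModule (PowerClasses.nsmul_eq_zero p F)

/-- The normal subgroups `N` of the free group on `X` of `p`-power index which contain all but
finitely many elements of `X`. -/
structure ProPKernel (p : ℕ) (X : Type*) where
  /-- The underlying subgroup. -/
  N : Subgroup (FreeGroup X)
  normal : N.Normal
  index_eq : ∃ k : ℕ, N.index = p ^ k
  cofinite : {x : X | FreeGroup.of x ∉ N}.Finite

instance {p : ℕ} {X : Type*} (N : ProPKernel p X) : N.N.Normal := N.normal

/-- The finite `p`-group `FreeGroup X ⧸ N`, with the discrete topology. -/
def ProPKernel.Quot {p : ℕ} {X : Type*} (N : ProPKernel p X) : Type _ := FreeGroup X ⧸ N.N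

instance {p : ℕ} {X : Type*} (N : ProPKernel p X) : Group N.Quot :=
  inferInstanceAs (Group (FreeGroup X ⧸ N.N))

instance {p : ℕ} {X : Type*} (N : ProPKernel p X) : TopologicalSpace N.Quot := ⊥

instance {p : ℕ} {X : Type*} (N : ProPKernel p X) : DiscreteTopology N.Quot := ⟨rfl⟩

/-- The projection `FreeGroup X → FreeGroup X ⧸ N`. -/
def ProPKernel.proj {p : ℕ} {X : Type*} (N : ProPKernel p X) : FreeGroup X →* N.Quot :=
  QuotientGroup.mk' N.N

/-- The projection `FreeGroup X ⧸ M → FreeGroup X ⧸ N` for `M ≤ N`. -/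
def ProPKernel.trans {p : ℕ} {X : Type*} {M N : ProPKernel p X} (h : M.N ≤ N.N) :
    M.Quot →* N.Quot :=
  QuotientGroup.map M.N N.N (MonoidHom.id _) h

/-- The free pro-`p` group on the set `X` (of generators converging to `1`): the inverse limit of
the groups `FreeGroup X ⧸ N`, over all normal subgroups `N` of `p`-power index which contain
almost all elements of `X`, inside their product. It carries the topology induced by the product
topology. -/
def FreeProP (p : ℕ) (X : Type*) : Subgroup (∀ N : ProPKernel p X, N.Quot) where
  carrier := {f | ∀ (M N : ProPKernel p X) (h : M.N ≤ N.N), ProPKernel.trans h (f M) = f N}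
  one_mem' := fun _ _ _ => map_one _
  mul_mem' := fun {f g} hf hg M N h => by
    rw [Pi.mul_apply, Pi.mul_apply, map_mul, hf M N h, hg M N h]
  inv_mem' := fun {f} hf M N h => by
    rw [Pi.inv_apply, Pi.inv_apply, map_inv, hf M N h]

/-- The generator of the free pro-`p` group on `X` given by `x : X`. -/
def FreeProP.of (p : ℕ) {X : Type*} (x : X) : FreeProP p X :=
  ⟨fun N => N.proj (FreeGroup.of x), fun _ _ _ => rfl⟩

instance {p : ℕ} {X : Type*} (R : Set (FreeProP p X)) :
    (Subgroup.normalClosure R).topologicalClosure.Normal :=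
  Subgroup.is_normal_topologicalClosure _

/-- The pro-`p` group `⟨X ∣ R⟩` with generating set `X` and set of relations `R`: the quotient of
the free pro-`p` group on `X` by the closed normal subgroup generated by `R`. -/
abbrev PresentedProP (p : ℕ) {X : Type*} (R : Set (FreeProP p X)) : Type _ :=
  FreeProP p X ⧸ (Subgroup.normalClosure R).topologicalClosure

/-- The relations `[τ_i, τ_j]`, for `i, j ∈ I`, in the free pro-`p` group on `τ_i`, `i ∈ I`. -/
def commutatorRelations (p : ℕ) (I : Type*) : Set (FreeProP p I) :=
  {r | ∃ i j : I,
    r = FreeProP.of p i * FreeProP.of p j * (FreeProP.of p i)⁻¹ * (FreeProP.of p j)⁻¹}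

/-!
A compact group is isomorphic to `∏ i ∈ I, ℤ_p` as soon as it carries continuous `ℤ_p`-valued
characters `χ i`, for `i ∈ I`, which separate points and are linearly independent modulo `p`: the
independence makes the image of the product map dense, by successive approximation modulo powers
of `p`, and compactness makes it closed.

Over a field `F ⊇ μ_{p^∞}`, the Kummer pairings modulo `p ^ n` glue to a pairing between `Fˣ` and
the Galois group of `CR(F)` with values in `ℤ_p`. Its reduction modulo `p` is nondegenerate on
`Fˣ / (Fˣ)^p`, so that a basis of `Fˣ / (Fˣ)^p` gives linearly independent characters; they
separate points since a homomorphism `Fˣ → ℤ_p` vanishing on a basis modulo `p`-th powers is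
divisible by every power of `p`. On the presented group, the characters are the exponents of
the generators; in the finite quotients, they detect the elements of the commutator subgroup.
-/

section PadicIntegers

open scoped Topology

variable {p : ℕ} [Fact p.Prime]

theorem toZModPow_eq_iff_pow_dvd_sub {n : ℕ} {x y : ℤ_[p]} :
    PadicInt.toZModPow n x = PadicInt.toZModPow n y ↔ (p : ℤ_[p]) ^ n ∣ x - y := by
  rw [← sub_eq_zero, ← map_sub, ← RingHom.mem_ker, PadicInt.ker_toZModPow,
    Ideal.mem_span_singleton]

theorem toZMod_eq_iff_dvd_sub {x y : ℤ_[p]} :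
    PadicInt.toZMod x = PadicInt.toZMod y ↔ (p : ℤ_[p]) ∣ x - y := by
  rw [← sub_eq_zero, ← map_sub, ← RingHom.mem_ker, PadicInt.ker_toZMod,
    PadicInt.maximalIdeal_eq_span_p, Ideal.mem_span_singleton]

theorem toZModPow_one_eq_zero_iff {x : ℤ_[p]} :
    PadicInt.toZModPow 1 x = 0 ↔ PadicInt.toZMod x = 0 := by
  rw [← map_zero (PadicInt.toZModPow 1), toZModPow_eq_iff_pow_dvd_sub, pow_one,
    ← toZMod_eq_iff_dvd_sub, map_zero]

theorem hasBasis_nhds_padicInt (x : ℤ_[p]) :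
    (𝓝 x).HasBasis (fun _ : ℕ => True)
      fun n => {y | PadicInt.toZModPow n y = PadicInt.toZModPow n x} := by
  have hp : 1 < (p : ℝ) := mod_cast (Fact.out : p.Prime).one_lt
  convert Metric.nhds_basis_closedBall_pow (x := x) (inv_pos.mpr (zero_lt_one.trans hp))
    (inv_lt_one_of_one_lt₀ hp) using 2 with n
  ext y
  rw [Set.mem_ofPred_eq, toZModPow_eq_iff_pow_dvd_sub, ← Ideal.mem_span_singleton,
    ← PadicInt.norm_le_pow_iff_mem_span_pow, mem_closedBall_iff_norm, zpow_neg, zpow_natCast,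
    inv_pow]

theorem continuous_of_continuous_toZModPow {T : Type*} [TopologicalSpace T] {f : T → ℤ_[p]}
    (hf : ∀ n, Continuous fun t => PadicInt.toZModPow n (f t)) : Continuous f := by
  refine continuous_iff_continuousAt.mpr fun t =>
    (hasBasis_nhds_padicInt (f t)).tendsto_right_iff.mpr fun n _ => ?_
  exact (hf n).continuousAt.eventually ((isOpen_discrete {_}).mem_nhds rfl)

theorem exists_toZModPow_eq (c : ∀ n, ZMod (p ^ n))
    (hc : ∀ n, ZMod.castHom (pow_dvd_pow p n.le_succ) (ZMod (p ^ n)) (c (n + 1)) = c n) :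
    ∃ z : ℤ_[p], ∀ n, PadicInt.toZModPow n z = c n := by
  have hdvd (n : ℕ) : (p : ℤ) ^ n ∣ ((c (n + 1)).val : ℤ) - ((c n).val : ℤ) := by
    rw [← Nat.cast_pow, ← ZMod.intCast_eq_intCast_iff_dvd_sub, Int.cast_natCast,
      Int.cast_natCast, ZMod.natCast_zmod_val, ZMod.natCast_val, ← hc n, ZMod.castHom_apply]
  refine ⟨PadicInt.ofIntSeq _ _, fun n =>
    (PadicInt.toZModPow_ofIntSeq_of_pow_dvd_sub (fun n => ((c n).val : ℤ)) p hdvd n).trans ?_⟩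
  rw [Int.cast_natCast, ZMod.natCast_zmod_val]

theorem exists_continuous_monoidHom_toZModPow_eq {G : Type*} [Group G] [TopologicalSpace G]
    (c : ∀ n, G →* Multiplicative (ZMod (p ^ n))) (hcont : ∀ n, Continuous (c n))
    (hc : ∀ n g, ZMod.castHom (pow_dvd_pow p n.le_succ) (ZMod (p ^ n)) (c (n + 1) g).toAdd =
      (c n g).toAdd) :
    ∃ χ : G →* Multiplicative ℤ_[p], Continuous χ ∧
      ∀ n g, PadicInt.toZModPow n (χ g).toAdd = (c n g).toAdd := by
  choose z hz using fun g => exists_toZModPow_eq (fun n => (c n g).toAdd) fun n => hc n g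
  have hz_mul (g h : G) : z (g * h) = z g + z h :=
    PadicInt.ext_of_toZModPow.mp fun n => by rw [map_add, hz, hz, hz, map_mul, toAdd_mul]
  have hz_cont : Continuous z := continuous_of_continuous_toZModPow fun n => by
    simp_rw [hz]
    exact continuous_toAdd.comp (hcont n)
  exact ⟨.mk' (fun g => .ofAdd (z g)) fun g h => congrArg Multiplicative.ofAdd (hz_mul g h),
    continuous_ofAdd.comp hz_cont, fun n g => hz g n⟩

variable {I : Type*}

theorem exists_mem_forall_pow_dvd_sub {H : AddSubgroup (I → ℤ_[p])}
    (hH : ∀ (J : Finset I) (v : J → ZMod p), ∃ h ∈ H, ∀ j : J, PadicInt.toZMod (h j) = v j)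
    (J : Finset I) (m : ℕ) (x : I → ℤ_[p]) : ∃ h ∈ H, ∀ j ∈ J, (p : ℤ_[p]) ^ m ∣ x j - h j := by
  induction m with
  | zero => exact ⟨0, H.zero_mem, fun j _ => by simp⟩
  | succ m ih =>
    obtain ⟨h, hhH, hh⟩ := ih
    choose! y hy using hh
    obtain ⟨g, hgH, hg⟩ := hH J fun j => PadicInt.toZMod (y j)
    refine ⟨h + p ^ m • g, H.add_mem hhH (H.nsmul_mem hgH _), fun j hj => ?_⟩
    have hdvd : (p : ℤ_[p]) ∣ y j - g j := toZMod_eq_iff_dvd_sub.mp (hg ⟨j, hj⟩).symm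
    calc (p : ℤ_[p]) ^ (m + 1) ∣ p ^ m * (y j - g j) := by
          rw [pow_succ]; exact mul_dvd_mul_left _ hdvd
      _ = x j - (h + p ^ m • g) j := by
          rw [mul_sub, ← hy j hj, Pi.add_apply, Pi.smul_apply, nsmul_eq_mul, Nat.cast_pow]; ring

theorem eq_top_of_isClosed_of_forall_toZMod {H : AddSubgroup (I → ℤ_[p])}
    (hclosed : IsClosed (H : Set (I → ℤ_[p])))
    (hH : ∀ (J : Finset I) (v : J → ZMod p), ∃ h ∈ H, ∀ j : J, PadicInt.toZMod (h j) = v j) :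
    H = ⊤ := by
  refine (AddSubgroup.eq_top_iff' H).mpr fun x => hclosed.closure_subset ?_
  have hbasis := Filter.hasBasis_pi fun i => hasBasis_nhds_padicInt (x i)
  rw [← nhds_pi] at hbasis
  refine (mem_closure_iff_nhds_basis hbasis).mpr ?_
  rintro ⟨S, k⟩ ⟨hS, -⟩
  obtain ⟨h, hhH, hh⟩ := exists_mem_forall_pow_dvd_sub hH hS.toFinset (hS.toFinset.sup k) x
  refine ⟨h, hhH, fun i hi => (toZModPow_eq_iff_pow_dvd_sub.mpr ?_).symm⟩
  have hi' := hS.mem_toFinset.mpr hi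
  exact (pow_dvd_pow _ (Finset.le_sup hi')).trans (hh i hi')

theorem exists_forall_eq_of_linearIndependent {G : Type*} [Group G]
    {c : I → G →* Multiplicative (ZMod p)}
    (hc : LinearIndependent (ZMod p) fun i (g : G) => (c i g).toAdd) (J : Finset I)
    (v : J → ZMod p) : ∃ g, ∀ j : J, (c j g).toAdd = v j := by
  let Φ : Additive G →+ (J → ZMod p) :=
    AddMonoidHom.mk' (fun g j => (c j g.toMul).toAdd) fun g h => by ext j; simp
  have hJ : LinearIndependent (ZMod p) fun (j : J) (g : G) => (c j g).toAdd :=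
    hc.comp _ Subtype.val_injective
  rw [← span_flip_eq_top_iff_linearIndependent, eq_top_iff] at hJ
  have hle : Submodule.span (ZMod p) (Set.range (flip fun (j : J) (g : G) => (c j g).toAdd)) ≤
      AddSubgroup.toZModSubmodule p Φ.range := by
    refine Submodule.span_le.mpr ?_
    rintro _ ⟨g, rfl⟩
    exact ⟨.ofMul g, rfl⟩
  obtain ⟨g, hg⟩ := hle (hJ (Submodule.mem_top (x := v)))
  exact ⟨g.toMul, congrFun hg⟩

theorem nonempty_continuousMulEquiv_pi_padicInt {G : Type*} [Group G] [TopologicalSpace G]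
    [CompactSpace G] (χ : I → G →* Multiplicative ℤ_[p]) (hcont : ∀ i, Continuous (χ i))
    (hinj : ∀ g, (∀ i, χ i g = 1) → g = 1)
    (hind : LinearIndependent (ZMod p) fun i (g : G) => PadicInt.toZMod (χ i g).toAdd) :
    Nonempty (G ≃ₜ* (I → Multiplicative ℤ_[p])) := by
  let Φ : G →* (I → Multiplicative ℤ_[p]) := MonoidHom.pi χ
  have hΦ : Continuous Φ := continuous_pi hcont
  have hΦ_inj : Function.Injective Φ :=
    (injective_iff_map_eq_one Φ).mpr fun g hg => hinj g (congrFun hg)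
  have hΦ_surj : Function.Surjective Φ := by
    let ev : Additive G →+ (I → ℤ_[p]) :=
      AddMonoidHom.mk' (fun g i => (χ i g.toMul).toAdd) fun g h => by ext i; simp
    have hrange : ev.range = ⊤ := by
      refine eq_top_of_isClosed_of_forall_toZMod ?_ fun J v => ?_
      · exact (isCompact_range (f := fun (g : G) i => (χ i g).toAdd)
          (continuous_pi fun i => continuous_toAdd.comp (hcont i))).isClosed
      · obtain ⟨g, hg⟩ := exists_forall_eq_of_linearIndependent
          (c := fun i => (PadicInt.toZMod.toAddMonoidHom.toMultiplicative).comp (χ i)) hind J v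
        exact ⟨_, ⟨.ofMul g, rfl⟩, hg⟩
    intro x
    obtain ⟨g, hg⟩ := AddMonoidHom.range_eq_top.mp hrange fun i => (x i).toAdd
    exact ⟨g.toMul, funext fun i => congrArg Multiplicative.ofAdd (congrFun hg i)⟩
  let e := MulEquiv.ofBijective Φ ⟨hΦ_inj, hΦ_surj⟩
  exact ⟨{ e with
    continuous_toFun := hΦ
    continuous_invFun :=
      (Continuous.homeoOfEquivCompactToT2 (f := e.toEquiv) hΦ).symm.continuous }⟩

theorem eq_one_of_closure_sup_range_powMonoidHom_eq_top {A : Type*} [CommGroup A] {S : Set A}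
    (hS : Subgroup.closure S ⊔ (powMonoidHom p).range = ⊤) {f : A →* Multiplicative ℤ_[p]}
    (hf : ∀ s ∈ S, f s = 1) : f = 1 := by
  have hdvd (n : ℕ) (a : A) : (p : ℤ_[p]) ^ n ∣ (f a).toAdd := by
    induction n generalizing a with
    | zero => simp
    | succ n ih =>
      have ha : a ∈ Subgroup.closure S ⊔ (powMonoidHom p).range := hS ▸ Subgroup.mem_top a
      obtain ⟨s, hs, _, ⟨b, rfl⟩, rfl⟩ := Subgroup.mem_sup.mp ha
      have hfs : f s = 1 := (Subgroup.closure_le f.ker).mpr hf hs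
      rw [map_mul, hfs, one_mul, powMonoidHom_apply, map_pow, toAdd_pow, nsmul_eq_mul, pow_succ']
      exact mul_dvd_mul_left _ (ih b)
  ext1 a
  refine Multiplicative.toAdd.injective (PadicInt.ext_of_toZModPow.mp fun n => ?_)
  exact toZModPow_eq_iff_pow_dvd_sub.mpr (by simpa using hdvd n a)

end PadicIntegers

section FreeProP

variable {p : ℕ} {X : Type*}

namespace ProPKernel

theorem proj_surjective (N : ProPKernel p X) : Function.Surjective N.proj :=
  QuotientGroup.mk'_surjective N.N

theorem proj_eq_one_iff {N : ProPKernel p X} {w : FreeGroup X} : N.proj w = 1 ↔ w ∈ N.N :=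
  QuotientGroup.eq_one_iff w

end ProPKernel

namespace FreeProP

theorem isClosed_coe : IsClosed (FreeProP p X : Set (∀ N : ProPKernel p X, N.Quot)) := by
  have : (FreeProP p X : Set (∀ N : ProPKernel p X, N.Quot)) =
      ⋂ (M : ProPKernel p X) (N : ProPKernel p X) (h : M.N ≤ N.N),
        {f | ProPKernel.trans h (f M) = f N} := by
    ext f
    simp only [Set.mem_iInter]
    rfl
  rw [this]
  exact isClosed_iInter fun M => isClosed_iInter fun N => isClosed_iInter fun h =>
    isClosed_eq (continuous_of_discreteTopology.comp (continuous_apply M)) (continuous_apply N)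

/-- The projection of the free pro-`p` group, an inverse limit, to its term of index `N`. -/
def eval (N : ProPKernel p X) : FreeProP p X →* N.Quot :=
  (Pi.evalMonoidHom (fun N : ProPKernel p X => N.Quot) N).comp (FreeProP p X).subtype

theorem continuous_comp_eval {T : Type*} [TopologicalSpace T] (N : ProPKernel p X)
    (f : N.Quot → T) : Continuous (f ∘ eval N) :=
  continuous_of_discreteTopology.comp ((continuous_apply N).comp continuous_subtype_val)

theorem eval_lift_of (N : ProPKernel p X) (w : FreeGroup X) :
    eval N (FreeGroup.lift (of p) w) = N.proj w := by
  have : (eval N).comp (FreeGroup.lift (of p)) = N.proj := by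
    ext x
    exact congrArg (eval N) FreeGroup.lift_apply_of
  exact DFunLike.congr_fun this w

theorem eval_surjective (N : ProPKernel p X) : Function.Surjective (eval N) := fun g => by
  obtain ⟨w, rfl⟩ := N.proj_surjective g
  exact ⟨_, eval_lift_of N w⟩

end FreeProP

namespace PresentedProP

/-- The generator of the pro-`p` group `⟨X ∣ R⟩` given by `x : X`. -/
def of (R : Set (FreeProP p X)) (x : X) : PresentedProP p R := FreeProP.of p x

theorem commute_of_of (x y : X) :
    Commute (of (commutatorRelations p X) x) (of (commutatorRelations p X) y) := by
  have h : FreeProP.of p x * FreeProP.of p y * (FreeProP.of p x)⁻¹ * (FreeProP.of p y)⁻¹ ∈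
      (Subgroup.normalClosure (commutatorRelations p X)).topologicalClosure :=
    Subgroup.le_topologicalClosure _ (Subgroup.subset_normalClosure ⟨x, y, rfl⟩)
  exact mul_inv_eq_iff_eq_mul.mp (mul_inv_eq_one.mp ((QuotientGroup.eq_one_iff _).mpr h))

instance (R : Set (FreeProP p X)) :
    IsClosed ((Subgroup.normalClosure R).topologicalClosure : Set (FreeProP p X)) :=
  Subgroup.isClosed_topologicalClosure _

end PresentedProP

variable [Fact p.Prime]

instance (N : ProPKernel p X) : Finite N.Quot := by
  obtain ⟨k, hk⟩ := N.index_eq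
  have : N.N.FiniteIndex := ⟨hk ▸ pow_ne_zero k (Fact.out : p.Prime).ne_zero⟩
  exact inferInstanceAs (Finite (FreeGroup X ⧸ N.N))

namespace ProPKernel

theorem isPGroup_quot (N : ProPKernel p X) : IsPGroup p N.Quot :=
  IsPGroup.iff_card.mpr N.index_eq

/-- The kernel of a homomorphism from a free group to a finite `p`-group which kills all but
finitely many generators, as an index of the inverse system defining the free pro-`p` group. -/
def ker {A : Type*} [Group A] [Finite A] (hA : IsPGroup p A) (f : FreeGroup X →* A)
    (hf : {x | f (FreeGroup.of x) ≠ 1}.Finite) : ProPKernel p X where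
  N := f.ker
  normal := inferInstance
  index_eq := by
    rw [Subgroup.index_ker]
    exact IsPGroup.iff_card.mp (hA.to_subgroup f.range)
  cofinite := hf

theorem exists_forall_le (T : Finset (ProPKernel p X)) :
    ∃ M : ProPKernel p X, ∀ N ∈ T, M.N ≤ N.N := by
  let f : FreeGroup X →* (∀ N : T, N.1.Quot) := MonoidHom.pi fun N => N.1.proj
  have hA : IsPGroup p (∀ N : T, N.1.Quot) := by
    choose k hk using fun N : T => IsPGroup.iff_card.mp N.1.isPGroup_quot
    exact IsPGroup.of_card (n := ∑ N, k N) (by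
      rw [Nat.card_pi, ← Finset.prod_pow_eq_pow_sum]
      exact Finset.prod_congr rfl fun N _ => hk N)
  have hf : {x | f (FreeGroup.of x) ≠ 1}.Finite := by
    refine (T.finite_toSet.biUnion fun N _ => N.cofinite).subset fun x hx => ?_
    obtain ⟨N, hN⟩ := Function.ne_iff.mp hx
    exact Set.mem_biUnion N.2 (mt proj_eq_one_iff.mpr hN)
  exact ⟨ker hA f hf, fun N hN w hw => proj_eq_one_iff.mp (congrFun hw ⟨N, hN⟩)⟩

end ProPKernel

namespace FreeProP

instance : CompactSpace (FreeProP p X) :=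
  isCompact_iff_compactSpace.mp isClosed_coe.isCompact

theorem mem_closure_of_forall_eval {S : Set (FreeProP p X)} {s : FreeProP p X}
    (hs : ∀ N : ProPKernel p X, ∃ r ∈ S, eval N r = eval N s) : s ∈ closure S := by
  have hbasis := (Filter.hasBasis_pi_pure s.1).comap (Subtype.val : FreeProP p X → _)
  simp only [← nhds_discrete] at hbasis
  rw [← nhds_pi, ← nhds_subtype] at hbasis
  refine (mem_closure_iff_nhds_basis hbasis).mpr fun T hT => ?_
  obtain ⟨M, hM⟩ := ProPKernel.exists_forall_le hT.toFinset
  obtain ⟨r, hr, hrs⟩ := hs M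
  refine ⟨r, hr, fun N hN => ?_⟩
  have hle := hM N (hT.mem_toFinset.mpr hN)
  calc r.1 N = ProPKernel.trans hle (r.1 M) := (r.2 M N hle).symm
    _ = ProPKernel.trans hle (s.1 M) := congrArg _ hrs
    _ = s.1 N := s.2 M N hle

theorem dense_closure_range_of :
    Dense (Subgroup.closure (Set.range (of p : X → FreeProP p X)) : Set (FreeProP p X)) := by
  intro s
  refine mem_closure_of_forall_eval fun N => ?_
  obtain ⟨w, hw⟩ := N.proj_surjective (eval N s)
  refine ⟨FreeGroup.lift (of p) w, ?_, (eval_lift_of N w).trans hw⟩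
  rw [← FreeGroup.range_lift_eq_closure]
  exact ⟨w, rfl⟩

theorem hom_ext {A : Type*} [Group A] [TopologicalSpace A] [T2Space A] {f g : FreeProP p X →* A}
    (hf : Continuous f) (hg : Continuous g) (h : ∀ x, f (of p x) = g (of p x)) : f = g := by
  have hle : Subgroup.closure (Set.range (of p)) ≤ f.eqLocus g :=
    (Subgroup.closure_le _).mpr (Set.range_subset_iff.mpr h)
  exact DFunLike.coe_injective (hf.ext_on dense_closure_range_of hg hle)

section lift

variable {A : Type*} [Group A] [Finite A] (hA : IsPGroup p A) (f : X → A)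
  (hf : {x | f x ≠ 1}.Finite)

/-- The extension to the free pro-`p` group of a map from its generators to a finite `p`-group
which is trivial on all but finitely many of them. -/
def lift : FreeProP p X →* A :=
  (QuotientGroup.kerLift (FreeGroup.lift f)).comp
    (eval (ProPKernel.ker hA (FreeGroup.lift f) (by simpa only [FreeGroup.lift_apply_of])))

@[simp]
theorem lift_of (x : X) : lift hA f hf (of p x) = f x :=
  FreeGroup.lift_apply_of

theorem continuous_lift [TopologicalSpace A] : Continuous (lift hA f hf) :=
  continuous_comp_eval _ _

end lift

section exponent

variable [DecidableEq X]

/-- The exponent, modulo `p ^ n`, of the generator given by `x` in the elements of the free pro-`p`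
group. -/
def exponentMod (x : X) (n : ℕ) : FreeProP p X →* Multiplicative (ZMod (p ^ n)) :=
  lift (IsPGroup.of_card (Nat.card_zmod (p ^ n))) (Pi.mulSingle x (.ofAdd 1))
    ((Set.finite_singleton x).subset Pi.mulSupport_mulSingle_subset)

theorem exponentMod_of (x : X) (n : ℕ) (y : X) :
    exponentMod x n (of p y) = if y = x then .ofAdd 1 else 1 :=
  (lift_of _ _ _ y).trans (Pi.mulSingle_apply x _ y)

theorem continuous_exponentMod (x : X) (n : ℕ) : Continuous (exponentMod (p := p) x n) :=
  continuous_lift _ _ _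

theorem castHom_exponentMod_succ (x : X) (n : ℕ) (s : FreeProP p X) :
    ZMod.castHom (pow_dvd_pow p n.le_succ) (ZMod (p ^ n)) (exponentMod x (n + 1) s).toAdd =
      (exponentMod x n s).toAdd := by
  let r := (ZMod.castHom (pow_dvd_pow p n.le_succ) (ZMod (p ^ n))).toAddMonoidHom.toMultiplicative
  have h : r.comp (exponentMod x (n + 1)) = exponentMod (p := p) x n := by
    refine hom_ext ((continuous_of_discreteTopology (f := r)).comp (continuous_exponentMod x _))
      (continuous_exponentMod x n) fun y => ?_
    rw [MonoidHom.comp_apply, exponentMod_of, exponentMod_of, apply_ite r, map_one r]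
    exact congrArg (ite (y = x) · 1)
      (congrArg Multiplicative.ofAdd (map_one (ZMod.castHom (pow_dvd_pow p n.le_succ) _)))
  exact congrArg Multiplicative.toAdd (DFunLike.congr_fun h s)

theorem exists_continuous_exponent (x : X) :
    ∃ φ : FreeProP p X →* Multiplicative ℤ_[p], Continuous φ ∧
      (∀ n s, PadicInt.toZModPow n (φ s).toAdd = (exponentMod x n s).toAdd) ∧
      ∀ y, (φ (of p y)).toAdd = if y = x then 1 else 0 := by
  obtain ⟨φ, hcont, hφ⟩ := exists_continuous_monoidHom_toZModPow_eq (exponentMod x)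
    (continuous_exponentMod x) (castHom_exponentMod_succ (p := p) x)
  refine ⟨φ, hcont, hφ, fun y => PadicInt.ext_of_toZModPow.mp fun n => ?_⟩
  rw [hφ, exponentMod_of]
  split_ifs
  · exact (map_one (PadicInt.toZModPow n)).symm
  · exact (map_zero (PadicInt.toZModPow n)).symm

theorem map_eq_one_of_exponentMod_eq_one {A : Type*} [CommGroup A] [TopologicalSpace A]
    [DiscreteTopology A] {n : ℕ} (hA : ∀ a : A, a ^ p ^ n = 1) {f : FreeProP p X →* A}
    (hf : Continuous f) (hfin : {x | f (of p x) ≠ 1}.Finite) {s : FreeProP p X}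
    (hs : ∀ x, exponentMod x n s = 1) : f s = 1 := by
  let ψ (x : X) : Multiplicative (ZMod (p ^ n)) →* A :=
    (AddChar.zmodChar (p ^ n) (hA (f (of p x)))).toMonoidHom
  have hprod : f = ∏ x ∈ hfin.toFinset, (ψ x).comp (exponentMod x n) := by
    refine hom_ext hf ?_ fun y => ?_
    · simp_rw [MonoidHom.coe_finsetProd, Finset.prod_fn]
      exact continuous_finsetProd _ fun x _ =>
        (continuous_of_discreteTopology (f := ψ x)).comp (continuous_exponentMod x n)
    · have hψ_one (x : X) : ψ x (.ofAdd 1) = f (of p x) := by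
        have h := AddChar.zmodChar_apply' (hA (f (of p x))) 1
        rw [Nat.cast_one, pow_one] at h
        exact h
      have hψ (x : X) : ψ x (exponentMod x n (of p y)) = if y = x then f (of p y) else 1 := by
        rw [exponentMod_of, apply_ite (ψ x), map_one (ψ x)]
        split_ifs with h
        · rw [hψ_one, h]
        · rfl
      simp_rw [MonoidHom.finsetProd_apply, MonoidHom.comp_apply, hψ, Finset.prod_ite_eq]
      simp
  rw [hprod, MonoidHom.finsetProd_apply]
  exact Finset.prod_eq_one fun x _ => by rw [MonoidHom.comp_apply, hs x, map_one]

end exponent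

theorem mem_closure_commutator_of_exponentMod_eq_one [DecidableEq X] {s : FreeProP p X}
    (hs : ∀ x n, exponentMod x n s = 1) :
    s ∈ closure (commutator (FreeProP p X) : Set (FreeProP p X)) := by
  refine mem_closure_of_forall_eval fun N => ?_
  let _ : TopologicalSpace (Abelianization N.Quot) := ⊥
  have : DiscreteTopology (Abelianization N.Quot) := ⟨rfl⟩
  let f : FreeProP p X →* Abelianization N.Quot := Abelianization.of.comp (eval N)
  obtain ⟨n, hn⟩ := isPGroup_iff_exists_pow_pow_eq_one.mp
    (N.isPGroup_quot.to_quotient (commutator N.Quot))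
  have hfin : {x | f (of p x) ≠ 1}.Finite := N.cofinite.subset fun x hx hxN => hx <| by
    have : eval N (of p x) = 1 := ProPKernel.proj_eq_one_iff.mpr hxN
    rw [MonoidHom.comp_apply, this, map_one]
  have hfs : f s = 1 := map_eq_one_of_exponentMod_eq_one hn
    (continuous_comp_eval N Abelianization.of) hfin (hs · n)
  have hcomm : eval N s ∈ (commutator (FreeProP p X)).map (eval N) := by
    rw [map_commutator_eq, MonoidHom.range_eq_top.mpr (eval_surjective N), ← commutator_def,
      ← Abelianization.ker_of]
    exact hfs
  exact hcomm

end FreeProP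

namespace PresentedProP

variable {R : Set (FreeProP p X)}

theorem hom_ext {A : Type*} [Group A] [TopologicalSpace A] [T2Space A]
    {f g : PresentedProP p R →* A} (hf : Continuous f) (hg : Continuous g)
    (h : ∀ x, f (of R x) = g (of R x)) : f = g := by
  refine QuotientGroup.monoidHom_ext _ (FreeProP.hom_ext ?_ ?_ h)
  · exact hf.comp QuotientGroup.continuous_mk
  · exact hg.comp QuotientGroup.continuous_mk

theorem commute (g h : PresentedProP p (commutatorRelations p X)) : Commute g h := by
  have conj_eq_id {g : PresentedProP p (commutatorRelations p X)}
      (hg : ∀ x, Commute g (of _ x)) : (MulAut.conj g).toMonoidHom = MonoidHom.id _ :=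
    hom_ext (IsTopologicalGroup.continuous_conj g) continuous_id
      fun x => mul_inv_eq_iff_eq_mul.mpr (hg x)
  have hof (x : X) : Commute (of _ x) g :=
    mul_inv_eq_iff_eq_mul.mp (DFunLike.congr_fun (conj_eq_id (commute_of_of x)) g)
  exact mul_inv_eq_iff_eq_mul.mp (DFunLike.congr_fun (conj_eq_id fun x => (hof x).symm) h)

theorem closure_commutator_subset :
    closure (commutator (FreeProP p X) : Set (FreeProP p X)) ⊆
      (Subgroup.normalClosure (commutatorRelations p X)).topologicalClosure :=
  closure_minimal
    (Subgroup.Normal.quotient_commutative_iff_commutator_le.mp ⟨⟨commute⟩⟩)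
    (Subgroup.isClosed_topologicalClosure _)

theorem nonempty_continuousMulEquiv_pi (p : ℕ) [Fact p.Prime] (I : Type*) :
    Nonempty (PresentedProP p (commutatorRelations p I) ≃ₜ* (I → Multiplicative ℤ_[p])) := by
  classical
  choose φ hφ_cont hφ hφ_of using FreeProP.exists_continuous_exponent (p := p) (X := I)
  have hker (i : I) :
      (Subgroup.normalClosure (commutatorRelations p I)).topologicalClosure ≤ (φ i).ker := by
    refine Subgroup.topologicalClosure_minimal _ (Subgroup.normalClosure_le_normal ?_)
      (isClosed_singleton.preimage (hφ_cont i))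
    rintro _ ⟨j, k, rfl⟩
    exact Abelianization.commutator_subset_ker (φ i)
      (Subgroup.commutator_mem_commutator (Subgroup.mem_top _) (Subgroup.mem_top _))
  refine nonempty_continuousMulEquiv_pi_padicInt (fun i => QuotientGroup.lift _ (φ i) (hker i))
    (fun i => (hφ_cont i).quotient_lift _) (fun g hg => ?_) ?_
  · obtain ⟨s, rfl⟩ := QuotientGroup.mk_surjective g
    refine (QuotientGroup.eq_one_iff s).mpr (closure_commutator_subset ?_)
    refine FreeProP.mem_closure_commutator_of_exponentMod_eq_one fun i n => ?_
    have hi : φ i s = 1 := hg i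
    exact Multiplicative.toAdd.injective (by rw [← hφ, hi, toAdd_one, map_zero, toAdd_one])
  · refine LinearIndependent.of_pairwise_dual_eq_zero_one _
      (fun j => LinearMap.proj (of (commutatorRelations p I) j)) (fun i j hij => ?_) fun i => ?_
    · exact (congrArg PadicInt.toZMod ((hφ_of j i).trans (if_neg hij))).trans (map_zero _)
    · exact (congrArg PadicInt.toZMod ((hφ_of i i).trans (if_pos rfl))).trans (map_one _)

end PresentedProP

end FreeProP

namespace PowerClasses

/-- The class of a unit in `Fˣ / (Fˣ)^p`. -/
def mk (p : ℕ) {F : Type*} [Field F] : Additive Fˣ →+ PowerClasses p F :=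
  MonoidHom.toAdditive (QuotientGroup.mk' (powMonoidHom p : Fˣ →* Fˣ).range)

variable {p : ℕ} {F : Type*} [Field F]

theorem mk_surjective : Function.Surjective (mk p (F := F)) :=
  QuotientGroup.mk'_surjective (powMonoidHom p : Fˣ →* Fˣ).range

theorem mk_eq_zero_iff {a : Additive Fˣ} : mk p a = 0 ↔ a.toMul ∈ (powMonoidHom p).range :=
  QuotientGroup.eq_one_iff a.toMul

variable {I : Type*} {a : I → Fˣ}

theorem linearIndependent_of_ker_le {M : Type*} [AddCommGroup M] [Module (ZMod p) M]
    (ha : LinearIndependent (ZMod p) fun i => mk p (.ofMul (a i))) {f : Additive Fˣ →+ M}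
    (hf : ∀ x, f x = 0 → mk p x = 0) : LinearIndependent (ZMod p) fun i => f (.ofMul (a i)) := by
  have hker : (mk p).ker ≤ f.ker := fun x hx => by
    obtain ⟨y, hy⟩ := mk_eq_zero_iff.mp hx
    have hyx : p • Additive.ofMul y = x := hy
    rw [AddMonoidHom.mem_ker, ← hyx, map_nsmul, ← Nat.cast_smul_eq_nsmul (ZMod p),
      CharP.cast_eq_zero, zero_smul]
  let g := ((mk p).liftOfSurjective mk_surjective ⟨f, hker⟩).toZModLinearMap p
  have hg (x : Additive Fˣ) : g (mk p x) = f x :=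
    (mk p).liftOfRightInverse_comp_apply _ (Function.rightInverse_surjInv _) ⟨f, hker⟩ x
  have hg_ker : g.ker = ⊥ := LinearMap.ker_eq_bot'.mpr fun z hz => by
    obtain ⟨x, rfl⟩ := mk_surjective z
    exact hf x ((hg x).symm.trans hz)
  simpa only [Function.comp_def, hg] using ha.map' g hg_ker

theorem closure_sup_range_powMonoidHom_eq_top
    (ha : Submodule.span (ZMod p) (Set.range fun i => mk p (.ofMul (a i))) = ⊤) :
    Subgroup.closure (Set.range a) ⊔ (powMonoidHom p).range = ⊤ := by
  let H := (Subgroup.closure (Set.range a)).toAddSubgroup.map (mk p)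
  have hle : Submodule.span (ZMod p) (Set.range fun i => mk p (.ofMul (a i))) ≤
      AddSubgroup.toZModSubmodule p H := by
    refine Submodule.span_le.mpr (Set.range_subset_iff.mpr fun i => ?_)
    have hi : a i ∈ Subgroup.closure (Set.range a) := Subgroup.subset_closure ⟨i, rfl⟩
    exact ⟨.ofMul (a i), hi, rfl⟩
  refine (Subgroup.eq_top_iff' _).mpr fun x => ?_
  obtain ⟨y, hy, hyx⟩ := hle (ha ▸ Submodule.mem_top (x := mk p (.ofMul x)))
  have hxy : mk p (.ofMul x - y) = 0 := by rw [map_sub, hyx, sub_self]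
  exact Subgroup.mem_sup.mpr
    ⟨y.toMul, hy, x / y.toMul, mk_eq_zero_iff.mp hxy, mul_div_cancel y.toMul x⟩

end PowerClasses

section Kummer

variable {F K : Type*} [Field F] [Field K] [Algebra F K] {N : ℕ}

theorem ne_zero_of_pow_eq_algebraMap [NeZero N] {a : Fˣ} {x : K}
    (hx : x ^ N = algebraMap F K a) : x ≠ 0 :=
  ne_zero_pow (NeZero.ne N) (hx ▸ (map_ne_zero _).mpr a.ne_zero)

theorem exists_eq_algebraMap_pow_mul [NeZero N] {ζ : F} (hζ : IsPrimitiveRoot ζ N) {a : Fˣ}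
    {x y : K} (hx : x ^ N = algebraMap F K a) (hy : y ^ N = algebraMap F K a) :
    ∃ k, y = algebraMap F K (ζ ^ k) * x := by
  have hroot : (y / x) ^ N = 1 := by
    rw [div_pow, hx, hy, div_self ((map_ne_zero _).mpr a.ne_zero)]
  obtain ⟨k, -, hk⟩ :=
    (hζ.map_of_injective (algebraMap F K).injective).eq_pow_of_pow_eq_one hroot
  exact ⟨k, by rw [map_pow, hk, div_mul_cancel₀ _ (ne_zero_of_pow_eq_algebraMap hx)]⟩

/-- `c` is the value at `σ` and `a` of the Kummer pairing modulo `N`, written additively by means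
of the `N`-th root of unity `ζ`: the automorphism `σ` multiplies the `N`-th roots of `a` by
`ζ ^ c`. -/
def IsKummerExponent (ζ : F) (σ : Gal(K/F)) (a : Fˣ) (c : ZMod N) : Prop :=
  ∀ x : K, x ^ N = algebraMap F K a → σ x = algebraMap F K (ζ ^ c.val) * x

namespace IsKummerExponent

variable {ζ : F} {σ τ : Gal(K/F)} {a b : Fˣ} {c d : ZMod N} {x y : K}

theorem apply_eq_self (h : IsKummerExponent ζ σ a (0 : ZMod N))
    (hx : x ^ N = algebraMap F K a) : σ x = x := by
  rw [h x hx, ZMod.val_zero, pow_zero, map_one, one_mul]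

variable [NeZero N]

theorem of_pow_eq (hζ : IsPrimitiveRoot ζ N) (hx : x ^ N = algebraMap F K a)
    (h : σ x = algebraMap F K (ζ ^ c.val) * x) : IsKummerExponent ζ σ a c := fun y hy => by
  obtain ⟨k, rfl⟩ := exists_eq_algebraMap_pow_mul hζ hx hy
  rw [map_mul, AlgEquiv.commutes, h, mul_left_comm]

theorem exists_of_pow_eq (hζ : IsPrimitiveRoot ζ N) (hx : x ^ N = algebraMap F K a)
    (σ : Gal(K/F)) : ∃ c : ZMod N, IsKummerExponent ζ σ a c := by
  have hσx : σ x ^ N = algebraMap F K a := by rw [← map_pow, hx, AlgEquiv.commutes]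
  obtain ⟨k, hk⟩ := exists_eq_algebraMap_pow_mul hζ hx hσx
  exact ⟨k, of_pow_eq hζ hx (by rw [hk, ← AddChar.zmodChar_apply' hζ.pow_eq_one]; rfl)⟩

theorem unique (hζ : IsPrimitiveRoot ζ N) (hx : x ^ N = algebraMap F K a)
    (hc : IsKummerExponent ζ σ a c) (hd : IsKummerExponent ζ σ a d) : c = d := by
  have h := mul_right_cancel₀ (ne_zero_of_pow_eq_algebraMap hx) ((hc x hx).symm.trans (hd x hx))
  exact ZMod.val_injective N
    (hζ.pow_inj c.val_lt d.val_lt ((algebraMap F K).injective h))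

theorem mul_aut (hζ : ζ ^ N = 1) (hc : IsKummerExponent ζ σ a c)
    (hd : IsKummerExponent ζ τ a d) : IsKummerExponent ζ (σ * τ) a (c + d) := fun x hx => by
  have hcd : ζ ^ (c + d).val = ζ ^ c.val * ζ ^ d.val :=
    (AddChar.zmodChar N hζ).map_add_eq_mul c d
  rw [AlgEquiv.mul_apply, hd x hx, map_mul, AlgEquiv.commutes, hc x hx, hcd, map_mul]
  ring

theorem mul_unit (hζ : IsPrimitiveRoot ζ N) (hx : x ^ N = algebraMap F K a)
    (hy : y ^ N = algebraMap F K b) (hc : IsKummerExponent ζ σ a c)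
    (hd : IsKummerExponent ζ σ b d) : IsKummerExponent ζ σ (a * b) (c + d) := by
  refine of_pow_eq hζ (x := x * y) (by rw [mul_pow, hx, hy, Units.val_mul, map_mul]) ?_
  have hcd : ζ ^ (c + d).val = ζ ^ c.val * ζ ^ d.val :=
    (AddChar.zmodChar N hζ.pow_eq_one).map_add_eq_mul c d
  rw [map_mul, hc x hx, hd y hy, hcd, map_mul]
  ring

theorem castHom {p n : ℕ} [NeZero p] {ζ' : F} (hζ : IsPrimitiveRoot ζ (p ^ n))
    (hζ' : ζ' ^ p = ζ) (hx : x ^ p ^ (n + 1) = algebraMap F K a) {c : ZMod (p ^ (n + 1))}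
    (hc : IsKummerExponent ζ' σ a c) :
    IsKummerExponent ζ σ a (ZMod.castHom (pow_dvd_pow p n.le_succ) (ZMod (p ^ n)) c) := by
  have hval : ζ ^ (ZMod.castHom (pow_dvd_pow p n.le_succ) (ZMod (p ^ n)) c).val =
      ζ ^ c.val := by
    rw [ZMod.castHom_apply, ← ZMod.natCast_val]
    exact AddChar.zmodChar_apply' hζ.pow_eq_one c.val
  refine of_pow_eq hζ (x := x ^ p) (by rw [← pow_mul, ← pow_succ', hx]) ?_
  rw [map_pow, hc x hx, hval, ← hζ', mul_pow, ← map_pow, pow_right_comm]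

theorem mem_range_powMonoidHom [IsGalois F K] (hx : x ^ N = algebraMap F K a)
    (h : ∀ σ : Gal(K/F), IsKummerExponent ζ σ a (0 : ZMod N)) : a ∈ (powMonoidHom N).range := by
  obtain ⟨b, rfl⟩ := (InfiniteGalois.mem_range_algebraMap_iff_fixed x).mpr
    fun σ => (h σ).apply_eq_self hx
  have hb : b ≠ 0 := (map_ne_zero _).mp (ne_zero_of_pow_eq_algebraMap hx)
  rw [← map_pow] at hx
  exact ⟨Units.mk0 b hb, Units.ext ((algebraMap F K).injective hx)⟩

end IsKummerExponent

theorem exists_kummerPairing [NeZero N] {ζ : F} (hζ : IsPrimitiveRoot ζ N)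
    (hroot : ∀ a : Fˣ, ∃ x : K, x ^ N = algebraMap F K a) :
    ∃ c : Fˣ →* Gal(K/F) →* Multiplicative (ZMod N),
      ∀ a σ, IsKummerExponent ζ σ a (c a σ).toAdd := by
  choose r hr using hroot
  choose c hc using fun a σ => IsKummerExponent.exists_of_pow_eq hζ (hr a) σ
  have hc_mul_aut (a : Fˣ) (σ τ : Gal(K/F)) : c a (σ * τ) = c a σ + c a τ :=
    (hc a (σ * τ)).unique hζ (hr a) ((hc a σ).mul_aut hζ.pow_eq_one (hc a τ))
  have hc_mul_unit (a b : Fˣ) (σ : Gal(K/F)) : c (a * b) σ = c a σ + c b σ :=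
    (hc (a * b) σ).unique hζ (hr _) ((hc a σ).mul_unit hζ (hr a) (hr b) (hc b σ))
  exact ⟨.mk' (fun a => .mk' (fun σ => .ofAdd (c a σ))
      fun σ τ => congrArg Multiplicative.ofAdd (hc_mul_aut a σ τ))
    fun a b => MonoidHom.ext fun σ => congrArg Multiplicative.ofAdd (hc_mul_unit a b σ), hc⟩

theorem continuous_of_forall_isKummerExponent [Algebra.IsAlgebraic F K] [NeZero N] {ζ : F}
    (hζ : IsPrimitiveRoot ζ N) {a : Fˣ} {x : K} (hx : x ^ N = algebraMap F K a)
    {c : Gal(K/F) →* Multiplicative (ZMod N)}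
    (hc : ∀ σ, IsKummerExponent ζ σ a (c σ).toAdd) : Continuous c := by
  refine continuous_of_continuousAt_one c ?_
  rw [ContinuousAt, map_one, nhds_discrete (Multiplicative (ZMod N)), Filter.tendsto_pure]
  have hopen := (stabilizer_isOpen_of_isIntegral (K := F) x).mem_nhds (one_mem _)
  filter_upwards [hopen] with σ (hσ : σ x = x)
  refine Multiplicative.toAdd.injective ((hc σ).unique hζ hx ?_)
  exact IsKummerExponent.of_pow_eq hζ hx (by rw [hσ]; simp)

variable {p : ℕ} [Fact p.Prime] {ζ : ℕ → F}

theorem exists_padicKummerPairing [Algebra.IsAlgebraic F K]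
    (hζ : ∀ n, IsPrimitiveRoot (ζ n) (p ^ n)) (hζ_succ : ∀ n, ζ (n + 1) ^ p = ζ n)
    (hroot : ∀ n (a : Fˣ), ∃ x : K, x ^ p ^ n = algebraMap F K a) :
    ∃ χ : Fˣ →* Gal(K/F) →* Multiplicative ℤ_[p], (∀ a, Continuous (χ a)) ∧
      ∀ n a σ, IsKummerExponent (ζ n) σ a (PadicInt.toZModPow n (χ a σ).toAdd) := by
  choose r hr using hroot
  choose c hc using fun n => exists_kummerPairing (K := K) (hζ n) fun a => ⟨r n a, hr n a⟩
  have hc_cont (n : ℕ) (a : Fˣ) : Continuous (c n a) :=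
    continuous_of_forall_isKummerExponent (hζ n) (hr n a) (hc n a)
  have hc_succ (n : ℕ) (a : Fˣ) (σ : Gal(K/F)) :
      ZMod.castHom (pow_dvd_pow p n.le_succ) (ZMod (p ^ n)) (c (n + 1) a σ).toAdd =
        (c n a σ).toAdd :=
    ((hc (n + 1) a σ).castHom (hζ n) (hζ_succ n) (hr _ a)).unique (hζ n) (hr n a) (hc n a σ)
  choose χ hχ_cont hχ using fun a => exists_continuous_monoidHom_toZModPow_eq (c · a)
    (hc_cont · a) (hc_succ · a)
  refine ⟨.mk' χ fun a b => ?_, hχ_cont, fun n a σ => ?_⟩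
  · ext1 σ
    refine Multiplicative.toAdd.injective (PadicInt.ext_of_toZModPow.mp fun n => ?_)
    rw [MonoidHom.mul_apply, toAdd_mul, map_add, hχ, hχ, hχ, map_mul, MonoidHom.mul_apply,
      toAdd_mul]
  · rw [MonoidHom.mk'_apply, hχ]
    exact hc n a σ

theorem nonempty_gal_continuousMulEquiv_pi [IsGalois F K]
    (hζ : ∀ n, IsPrimitiveRoot (ζ n) (p ^ n)) (hζ_succ : ∀ n, ζ (n + 1) ^ p = ζ n)
    (hroot : ∀ n (a : Fˣ), ∃ x : K, x ^ p ^ n = algebraMap F K a)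
    (hK : ∀ σ : Gal(K/F),
      (∀ n (a : Fˣ) (x : K), x ^ p ^ n = algebraMap F K a → σ x = x) → σ = 1)
    {I : Type*} (b : Module.Basis I (ZMod p) (PowerClasses p F)) :
    Nonempty (Gal(K/F) ≃ₜ* (I → Multiplicative ℤ_[p])) := by
  obtain ⟨χ, hχ_cont, hχ⟩ := exists_padicKummerPairing hζ hζ_succ hroot
  choose a ha using fun i => PowerClasses.mk_surjective (b i)
  refine nonempty_continuousMulEquiv_pi_padicInt (fun i => χ (a i).toMul)
    (fun i => hχ_cont _) (fun σ hσ => hK σ fun n c x hx => ?_) ?_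
  · have hspan : Submodule.span (ZMod p) (Set.range fun i => PowerClasses.mk p (a i)) = ⊤ := by
      simp only [ha, b.span_eq]
    have hχσ : (MonoidHom.eval σ).comp χ = 1 :=
      eq_one_of_closure_sup_range_powMonoidHom_eq_top
        (PowerClasses.closure_sup_range_powMonoidHom_eq_top hspan) (Set.forall_mem_range.mpr hσ)
    have hcσ : χ c σ = 1 := DFunLike.congr_fun hχσ c
    have h := hχ n c σ
    rw [hcσ, toAdd_one, map_zero] at h
    exact h.apply_eq_self hx
  · let κ : Additive Fˣ →+ (Gal(K/F) → ZMod p) :=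
      AddMonoidHom.mk' (fun a σ => PadicInt.toZMod (χ a.toMul σ).toAdd) fun a b => by ext σ; simp
    refine PowerClasses.linearIndependent_of_ker_le (f := κ) (a := fun i => (a i).toMul) ?_
      fun x hx => ?_
    · simpa only [ofMul_toMul, ha] using b.linearIndependent
    · obtain ⟨y, hy⟩ := hroot 1 x.toMul
      have hx' (σ : Gal(K/F)) : PadicInt.toZModPow 1 (χ x.toMul σ).toAdd = 0 :=
        toZModPow_one_eq_zero_iff.mpr (congrFun hx σ)
      have hmem := IsKummerExponent.mem_range_powMonoidHom hy fun σ => hx' σ ▸ hχ 1 x.toMul σ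
      rw [pow_one] at hmem
      exact PowerClasses.mk_eq_zero_iff.mpr hmem

end Kummer

section CyclotomicRadical

variable {p : ℕ} {F L : Type*} [Field F] [Field L] [Algebra F L]

theorem cyclotomicRadicalExt_eq_adjoin :
    cyclotomicRadicalExt p F L = IntermediateField.adjoin F
      {x : L | ∃ m : ℕ, 1 ≤ m ∧ ∃ a : Fˣ, x ^ p ^ m = algebraMap F L a} := by
  refine le_antisymm ?_ (IntermediateField.adjoin_le_iff.mpr ?_)
  · refine iSup_le fun m => iSup_le fun hm => iSup_le fun a =>
      IntermediateField.adjoin.mono F _ _ ?_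
    rintro x (hx | hx)
    · exact ⟨m, hm, a, hx⟩
    · exact ⟨m, hm, 1, by rw [IsPrimitiveRoot.pow_eq_one hx, Units.val_one, map_one]⟩
  · rintro x ⟨m, hm, a, hx⟩
    have h : radicalExt p F L a m ≤ cyclotomicRadicalExt p F L :=
      le_iSup_of_le m (le_iSup_of_le hm (le_iSup_of_le a le_rfl))
    exact h (IntermediateField.subset_adjoin F _ (Or.inl hx))

theorem isGalois_cyclotomicRadicalExt [IsGalois F L] :
    IsGalois F (cyclotomicRadicalExt p F L) := by
  have hnormal : Normal F (cyclotomicRadicalExt p F L) := by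
    rw [IntermediateField.normal_iff_forall_map_le]
    intro σ
    rw [cyclotomicRadicalExt_eq_adjoin, IntermediateField.adjoin_map]
    refine IntermediateField.adjoin.mono F _ _ ?_
    rintro _ ⟨x, ⟨m, hm, a, hx⟩, rfl⟩
    refine ⟨m, hm, a, ?_⟩
    rw [← map_pow, hx, AlgHom.commutes]
  exact ⟨⟩

theorem mem_cyclotomicRadicalExt_of_pow_eq {x : L} {m : ℕ} {a : Fˣ}
    (hx : x ^ p ^ m = algebraMap F L a) : x ∈ cyclotomicRadicalExt p F L := by
  rw [cyclotomicRadicalExt_eq_adjoin]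
  refine IntermediateField.subset_adjoin F _ ⟨m + 1, m.succ_pos, a ^ p, ?_⟩
  rw [pow_succ, pow_mul, hx, Units.val_pow_eq_pow_val, map_pow]

theorem gal_cyclotomicRadicalExt_eq_one_of_forall_apply_eq {σ : Gal(cyclotomicRadicalExt p F L/F)}
    (hσ : ∀ n (a : Fˣ) (x : cyclotomicRadicalExt p F L),
      x ^ p ^ n = algebraMap F (cyclotomicRadicalExt p F L) a → σ x = x) : σ = 1 := by
  have h : (σ : cyclotomicRadicalExt p F L →ₐ[F] cyclotomicRadicalExt p F L) = AlgHom.id F _ := by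
    refine IntermediateField.algHom_ext_of_eq_adjoin _ cyclotomicRadicalExt_eq_adjoin ?_
    rintro x ⟨m, -, a, hx⟩
    exact hσ m a _ (Subtype.ext hx)
  exact AlgEquiv.ext fun x => DFunLike.congr_fun h x

variable [Fact p.Prime]

theorem isPrimitiveRoot_pow_succ_of_pow_eq {M : Type*} [CommMonoid M] {ζ ξ : M} {n : ℕ}
    (hζ : IsPrimitiveRoot ζ (p ^ (n + 1))) (hξ : ξ ^ p = ζ) :
    IsPrimitiveRoot ξ (p ^ (n + 2)) := by
  have hp : p.Prime := Fact.out
  refine IsPrimitiveRoot.iff_orderOf.mpr (orderOf_eq_prime_pow (fun h => ?_) ?_)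
  · rw [pow_succ', pow_mul, hξ] at h
    exact hζ.pow_ne_one_of_pos_of_lt (pow_ne_zero n hp.ne_zero)
      (Nat.pow_lt_pow_right hp.one_lt n.lt_succ_self) h
  · rw [pow_succ', pow_mul, hξ, hζ.pow_eq_one]

theorem exists_seq_isPrimitiveRoot [IsSepClosed L] (hp : (p : L) ≠ 0) :
    ∃ ζ : ℕ → L, (∀ n, IsPrimitiveRoot (ζ n) (p ^ n)) ∧ ∀ n, ζ (n + 1) ^ p = ζ n := by
  have : NeZero (p : L) := ⟨hp⟩
  obtain ⟨ζ₁, hζ₁⟩ := HasEnoughRootsOfUnity.exists_primitiveRoot L p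
  choose r hr using fun y : L => IsSepClosed.exists_pow_nat_eq y p
  have hζ (n : ℕ) : IsPrimitiveRoot (r^[n] ζ₁) (p ^ (n + 1)) := by
    induction n with
    | zero => simpa using hζ₁
    | succ n ih =>
      exact isPrimitiveRoot_pow_succ_of_pow_eq ih (by rw [Function.iterate_succ_apply', hr])
  refine ⟨fun n => (r^[n] ζ₁) ^ p, fun n => ?_, fun n => ?_⟩
  · exact (hζ n).pow (NeZero.pos _) (pow_succ' p n)
  · beta_reduce
    rw [Function.iterate_succ_apply', hr]

theorem nonempty_gal_cyclotomicRadicalExt_continuousMulEquiv_pi [IsSepClosure F L]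
    (hp : (p : F) ≠ 0) (hmu : muPInf p L ⊆ Set.range (algebraMap F L)) {I : Type*}
    (b : Module.Basis I (ZMod p) (PowerClasses p F)) :
    Nonempty (Gal(cyclotomicRadicalExt p F L/F) ≃ₜ* (I → Multiplicative ℤ_[p])) := by
  have : IsSepClosed L := IsSepClosure.sep_closed F
  have : IsGalois F (cyclotomicRadicalExt p F L) := isGalois_cyclotomicRadicalExt
  have hpL : (p : L) ≠ 0 := by
    rw [← map_natCast (algebraMap F L)]
    exact (map_ne_zero _).mpr hp
  have hinj := (algebraMap F L).injective
  obtain ⟨ξ, hξ, hξ_succ⟩ := exists_seq_isPrimitiveRoot hpL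
  have hξF (n : ℕ) : ξ n ∈ Set.range (algebraMap F L) :=
    hmu ⟨n + 1, n.succ_pos, by rw [pow_succ, pow_mul, (hξ n).pow_eq_one, one_pow]⟩
  choose ζ hζ using hξF
  refine nonempty_gal_continuousMulEquiv_pi (ζ := ζ)
    (fun n => .of_map_of_injective (hζ n ▸ hξ n) hinj)
    (fun n => hinj (by rw [map_pow, hζ, hζ, hξ_succ])) (fun n a => ?_)
    (fun _ => gal_cyclotomicRadicalExt_eq_one_of_forall_apply_eq) b
  have : NeZero ((p ^ n : ℕ) : L) := ⟨by rw [Nat.cast_pow]; exact pow_ne_zero n hpL⟩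
  obtain ⟨x, hx⟩ := IsSepClosed.exists_pow_nat_eq (algebraMap F L a) (p ^ n)
  exact ⟨⟨x, mem_cyclotomicRadicalExt_of_pow_eq hx⟩, Subtype.ext hx⟩

end CyclotomicRadical

theorem theorem4p1 (p : ℕ) [Fact p.Prime]
    (F : Type u) [Field F] (Fsep : Type v) [Field Fsep] [Algebra F Fsep] [IsSepClosure F Fsep]
    (hp : (p : F) ≠ 0)
    (hmu : muPInf p Fsep ⊆ Set.range (algebraMap F Fsep))
    (I : Type w)
    (hI : Cardinal.lift.{u} (Cardinal.mk I) =
      Cardinal.lift.{w} (Module.rank (ZMod p) (PowerClasses p F))) :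
    IsGalois F (cyclotomicRadicalExt p F Fsep) ∧
    Nonempty (Gal(cyclotomicRadicalExt p F Fsep/F) ≃ₜ*
      PresentedProP p (commutatorRelations p I)) ∧
    Nonempty (PresentedProP p (commutatorRelations p I) ≃ₜ*
      (I → Multiplicative ℤ_[p])) := by
  have : IsGalois F Fsep := inferInstance
  let b := Module.Basis.ofVectorSpace (ZMod p) (PowerClasses p F)
  rw [← b.mk_eq_rank''] at hI
  obtain ⟨e⟩ := Cardinal.lift_mk_eq'.mp hI
  obtain ⟨f⟩ := nonempty_gal_cyclotomicRadicalExt_continuousMulEquiv_pi hp hmu (b.reindex e.symm)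
  obtain ⟨g⟩ := PresentedProP.nonempty_continuousMulEquiv_pi p I
  exact ⟨isGalois_cyclotomicRadicalExt, ⟨f.trans g.symm⟩, ⟨g⟩⟩
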